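/- **Theorem 1.** Let $\mathcal X\subset\mathbb R^p$ and $\mathcal Y\subset\mathbb R$ be compact, and let $\mathcal H$ be a reproducing kernel Hilbert space of real functions on $\mathcal X$ whose kernel $\kappa$ is measurable and satisfies $\sup_{x\in\mathcal X}\sqrt{\kappa(x,x)}<\infty$. Let $\ell:\mathbb R\times\mathcal Y\to\mathbb R$, $(z,y)\mapsto\ell(z,y)$, be measurable in $y$, and suppose that for every $y\in\mathcal Y$ the function $\ell(\cdot,y)$ is convex, differentiable and $C$-Lipschitz on $\mathbb R$, with the same constant $C$ for all $y$; write $\ell'$ for its derivative in $z$. Let $(x_t,y_t)_{t\ge 0}$ be i.i.d. random pairs in $\mathcal X\times\mathcal Y$ with the law of $(x,y)$, let $\lambda>0$, and let $$R(f)=\mathbb E[\ell(f(x),y)]+\tfrac{\lambda}{2}\|f\|_{\mathcal H}^2,\qquad f\in\mathcal H,$$ where $\ell(f(x),y)$ is assumed integrable for every $f\in\mathcal H$. Let $f^*$ be a minimizer of $R$ over $\mathcal H$. Let $(f_t)_{t\ge0}$ be generated by Parsimonious Online Learning with Kernels (POLK) with step sizes $\eta_t>0$ and budgets $\varepsilon_t>0$.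 That is, $f_0=0$ with empty dictionary, and, given $f_t=\sum_{n=1}^{M_t} w_n\kappa(d_n,\cdot)$, one forms $$\tilde f_{t+1}=(1-\eta_t\lambda)f_t-\eta_t\,\ell'(f_t(x_t),y_t)\,\kappa(x_t,\cdot),$$ with dictionary $[d_1,\dots,d_{M_t},x_t]$ and coefficients $[(1-\eta_t\lambda)w_1,\dots,(1-\eta_t\lambda)w_{M_t},\,-\eta_t\ell'(f_t(x_t),y_t)]$. Then $f_{t+1}$, with its dictionary and coefficients, is the output of destructive kernel orthogonal matching pursuit (KOMP) run on $\tilde f_{t+1}$ with budget $\varepsilon_t$: as long as the current dictionary is non-empty, for each of its elements $d_j$ compute the least error $\gamma_j=\min_{w}\big\|\tilde f_{t+1}-\sum_{k\ne j}w_k\kappa(d_k,\cdot)\big\|_{\mathcal H}$ attainable without $d_j$, and choose $j^*$ minimizing $\gamma_j$; if $\gamma_{j^*}>\varepsilon_t$, stop and return the current function; otherwise remove $d_{j^*}$, replace the coefficients by ones minimizing the Hilbert-norm error to $\tilde f_{t+1}$ over the remaining dictionary, and repeat. Ties among minimizers may be broken arbitrarily. Suppose that $$\sum_{t}\eta_t=\infty,\qquad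 \sum_t\eta_t^2<\infty,\qquad \varepsilon_t=\eta_t^2,\qquad \eta_t<\frac1\lambda\ \text{ for all } t.$$ Then $$\liminf_{t\to\infty}R(f_t)-R(f^*)=0\quad\text{almost surely},\qquad\text{and}\qquad \lim_{t\to\infty}\|f_t-f^*\|_{\mathcal H}^2=0\quad\text{almost surely}.$$ -/

import Mathlib

open MeasureTheory ProbabilityTheory Filter Topology

/-- A finite kernel expansion: a dictionary `d₁, …, d_M` of points of `X` (`M` is the model order)
together with coefficients `w₁, …, w_M`. -/
structure KernelExpansion (X : Type*) where
  order : ℕ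
  dict : Fin order → X
  coeff : Fin order → ℝ

section RKHSNotions

variable {X : Type*} (H : Type*) [NormedAddCommGroup H] [InnerProductSpace ℝ H] [CompleteSpace H]
  [RKHS ℝ H X ℝ]

/-- The scalar reproducing kernel `κ(x, x')` of `H`. -/
noncomputable def reproducingKernel (x x' : X) : ℝ := RKHS.kernel H x x' 1

/-- The element `κ(x, ·)` of `H`. -/
noncomputable def kernelSection (x : X) : H := RKHS.kerFun H x 1

/-- The function `∑ n, w n • κ(d n, ·)` of `H` with dictionary `d` and coefficients `w`. -/
noncomputable def kernelSum {M : ℕ} (d : Fin M → X) (w : Fin M → ℝ) : H :=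
  ∑ n, w n • kernelSection H (d n)

/-- The element of `H` represented by a kernel expansion. -/
noncomputable def KernelExpansion.toRKHS (A : KernelExpansion X) : H :=
  kernelSum H A.dict A.coeff

theorem reproducingKernel_eq_kernelSection_apply (x x' : X) :
    reproducingKernel H x x' = kernelSection H x' x := by
  simp [reproducingKernel, kernelSection, RKHS.kerFun_apply]

variable {H}

/-- The reproducing property `⟨f, κ(x, ·)⟩ = f(x)`. -/
theorem inner_kernelSection (f : H) (x : X) : inner ℝ f (kernelSection H x) = f x := by
  simp [kernelSection]

/-- The weights `w` minimize the Hilbert-norm error in approximating `g` over the dictionary `d`. -/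
def IsBestCoeff (g : H) {M : ℕ} (d : Fin M → X) (w : Fin M → ℝ) : Prop :=
  ∀ v : Fin M → ℝ, ‖g - kernelSum H d w‖ ≤ ‖g - kernelSum H d v‖

/-- The approximation error `γ_j` of `g` after the dictionary element `d j` is removed. -/
noncomputable def removalError (g : H) {M : ℕ} (d : Fin (M + 1) → X) (j : Fin (M + 1)) : ℝ :=
  ⨅ w : Fin M → ℝ, ‖g - kernelSum H (j.removeNth d) w‖

/-- The loop of destructive kernel orthogonal matching pursuit with pre-fitting, for the target
function `g` and the error budget `ε`: `KOMPLoop g ε A B` says that the loop, entered with the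
current expansion `A`, can return `B`. Ties in the choice of the removed element and of the weights
may be broken in any way. -/
inductive KOMPLoop (g : H) (ε : ℝ) : KernelExpansion X → KernelExpansion X → Prop
  | empty (d : Fin 0 → X) (w : Fin 0 → ℝ) : KOMPLoop g ε ⟨0, d, w⟩ ⟨0, d, w⟩
  | halt {M : ℕ} (d : Fin (M + 1) → X) (w : Fin (M + 1) → ℝ) (j : Fin (M + 1))
      (argmin : ∀ i, removalError g d j ≤ removalError g d i)
      (exceeds : ε < removalError g d j) :
      KOMPLoop g ε ⟨M + 1, d, w⟩ ⟨M + 1, d, w⟩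
  | prune {M : ℕ} (d : Fin (M + 1) → X) (w : Fin (M + 1) → ℝ) (j : Fin (M + 1))
      (argmin : ∀ i, removalError g d j ≤ removalError g d i)
      (within : removalError g d j ≤ ε)
      (w' : Fin M → ℝ) (refit : IsBestCoeff g (j.removeNth d) w')
      (B : KernelExpansion X) (rest : KOMPLoop g ε ⟨M, j.removeNth d, w'⟩ B) :
      KOMPLoop g ε ⟨M + 1, d, w⟩ B

variable (H) in
/-- `B` is an output of destructive KOMP run on the function represented by `A`, with the dictionary
and coefficients of `A` and error budget `ε`. -/
def KOMP (ε : ℝ) (A B : KernelExpansion X) : Prop := KOMPLoop (A.toRKHS H) ε A B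

variable {Y : Type*}

/-- The derivative `ℓ'(z, y)` of the loss in its first, scalar, argument. -/
noncomputable def lossDeriv (loss : ℝ → Y → ℝ) (z : ℝ) (y : Y) : ℝ := deriv (fun u => loss u y) z

variable (H) in
/-- The unconstrained functional stochastic gradient step: append the sample `x` to the dictionary,
scale the old coefficients by `1 - ηλ` and give `x` the coefficient `-η ℓ'(f(x), y)`. -/
noncomputable def sgdStep (loss : ℝ → Y → ℝ) (lam η : ℝ) (A : KernelExpansion X) (x : X) (y : Y) :
    KernelExpansion X where
  order := A.order + 1
  dict := Fin.snoc A.dict x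
  coeff := Fin.snoc (fun n => (1 - η * lam) * A.coeff n) (-(η * lossDeriv loss (A.toRKHS H x) y))

/-- The step represents `(1 - ηλ) f - η ℓ'(f(x), y) κ(x, ·)`. -/
theorem toRKHS_sgdStep (loss : ℝ → Y → ℝ) (lam η : ℝ) (A : KernelExpansion X) (x : X) (y : Y) :
    (sgdStep H loss lam η A x y).toRKHS H =
      (1 - η * lam) • A.toRKHS H - (η * lossDeriv loss (A.toRKHS H x) y) • kernelSection H x := by
  have h : (sgdStep H loss lam η A x y).toRKHS H =
      ∑ n : Fin (A.order + 1), (Fin.snoc (α := fun _ => ℝ) (fun n => (1 - η * lam) * A.coeff n)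
        (-(η * lossDeriv loss (A.toRKHS H x) y)) n : ℝ) •
          kernelSection H (Fin.snoc (α := fun _ => X) A.dict x n) := rfl
  have hA : A.toRKHS H = ∑ n, A.coeff n • kernelSection H (A.dict n) := rfl
  rw [h, Fin.sum_univ_castSucc]
  simp only [Fin.snoc_castSucc, Fin.snoc_last, mul_smul, ← Finset.smul_sum, ← hA, neg_smul]
  exact (sub_eq_add_neg _ _).symm

variable (H) in
/-- `A 0, A 1, …` are the expansions of a run of POLK on the training stream `z` with step sizes
`η`, error budgets `ε` and regularizer `lam`, started at the empty expansion (`f₀ = 0`). -/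
structure IsPOLKRun (loss : ℝ → Y → ℝ) (lam : ℝ) (η ε : ℕ → ℝ) (z : ℕ → X × Y)
    (A : ℕ → KernelExpansion X) : Prop where
  start : (A 0).order = 0
  step : ∀ t, KOMP H (ε t) (sgdStep H loss lam (η t) (A t) (z t).1 (z t).2) (A (t + 1))

/-- The regularized expected risk `R(f) = E[ℓ(f(x), y)] + (λ/2) ‖f‖²` for `(x, y) ∼ P`. -/
noncomputable def regularizedRisk [MeasurableSpace X] [MeasurableSpace Y] (P : Measure (X × Y))
    (loss : ℝ → Y → ℝ) (lam : ℝ) (f : H) : ℝ :=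
  ∫ q, loss (f q.1) q.2 ∂P + lam / 2 * ‖f‖ ^ 2

end RKHSNotions

/-! The randomness is split off into a linear recursion that does not see the iterates. Let `ξ` be
the stochastic gradient at the minimizer `f*`, and let `e` be driven by the noise `ξ(z_t)` along the
same samples (`noiseRecursion`). By first-order optimality `ξ` is weakly centred, and it is bounded.

For `e`, orthogonality of the noise to the past gives `E‖e_t‖² → 0`, while `‖e_t‖²`, compensated by
a multiple of `∑ η²`, is up to sign a bounded submartingale. So `‖e_t‖²` converges almost surely,
and the limit must be `0` (`ae_tendsto_norm_noiseRecursion`).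

The remaining comparison of `f_t` with `f* + e_t` is deterministic on each path. Since `ℓ'` is
monotone, the squared distance contracts by `(1 - λη)²`, up to an error `η · o(1)`
(`norm_sq_gradientStep_sub_le`); pruning moves the iterate by at most `η²`. Hence `f_t → f*`
wherever `e_t → 0` (`IsPOLKRun.tendsto_toRKHS`). As no expectation of `f_t` is taken, the
tie-breaking rule need not be measurable. Convergence of the risk follows by continuity. -/

/-! ### A deterministic recursion and a consequence of independence. -/

/-- A nonnegative sequence with `u (n + 1) ≤ (1 - a n) u n + a n b n`, where `∑ a n = ∞` and
`b n → 0`, converges to `0`. -/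
theorem tendsto_zero_of_le_one_sub_mul_add {u a b : ℕ → ℝ} (hu : ∀ n, 0 ≤ u n)
    (ha0 : ∀ n, 0 ≤ a n) (ha1 : ∀ n, a n ≤ 1)
    (ha : Tendsto (fun n => ∑ t ∈ Finset.range n, a t) atTop atTop)
    (hb : Tendsto b atTop (𝓝 0)) (h : ∀ n, u (n + 1) ≤ (1 - a n) * u n + a n * b n) :
    Tendsto u atTop (𝓝 0) := by
  rw [Metric.tendsto_atTop']
  intro c hc
  have hc2 : 0 < c / 2 := half_pos hc
  obtain ⟨N, hN⟩ := eventually_atTop.1 (hb.eventually (gt_mem_nhds hc2))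
  -- Once `b ≤ c / 2`, the excess of `u` over `c / 2`, truncated at `0`, shrinks by `1 - a ≤ exp
  -- (-a)` at each step.
  have key : ∀ k, max (u (N + k) - c / 2) 0 ≤ max (u N - c / 2) 0 *
      Real.exp (∑ t ∈ Finset.range N, a t - ∑ t ∈ Finset.range (N + k), a t) := by
    intro k
    induction k with
    | zero => simp
    | succ k ih =>
      have h1 : max (u (N + (k + 1)) - c / 2) 0 ≤ (1 - a (N + k)) * max (u (N + k) - c / 2) 0 := by
        refine max_le ?_ (mul_nonneg (by linarith [ha1 (N + k)]) (le_max_right _ _))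
        have h2 := h (N + k)
        have h3 := mul_le_mul_of_nonneg_left (hN (N + k) (by omega)).le (ha0 (N + k))
        have h4 := mul_le_mul_of_nonneg_left (le_max_left (u (N + k) - c / 2) 0)
          (sub_nonneg.2 (ha1 (N + k)))
        rw [← add_assoc]
        linarith
      have h5 : 1 - a (N + k) ≤ Real.exp (-a (N + k)) := by
        linarith [Real.add_one_le_exp (-a (N + k))]
      calc _ ≤ _ := h1
        _ ≤ Real.exp (-a (N + k)) * max (u (N + k) - c / 2) 0 :=
          mul_le_mul_of_nonneg_right h5 (le_max_right _ _)
        _ ≤ Real.exp (-a (N + k)) * _ := mul_le_mul_of_nonneg_left ih (Real.exp_nonneg _)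
        _ = _ := by
          rw [mul_left_comm, ← Real.exp_add, ← add_assoc N k 1, Finset.sum_range_succ]
          ring_nf
  have hlim : Tendsto (fun n => max (u N - c / 2) 0 *
      Real.exp (∑ t ∈ Finset.range N, a t - ∑ t ∈ Finset.range n, a t)) atTop (𝓝 0) := by
    suffices h1 : Tendsto (fun n => Real.exp (∑ t ∈ Finset.range N, a t -
        ∑ t ∈ Finset.range n, a t)) atTop (𝓝 0) by
      simpa using h1.const_mul (max (u N - c / 2) 0)
    refine Real.tendsto_exp_atBot.comp ?_
    exact tendsto_const_nhds.add_atBot (tendsto_neg_atTop_atBot.comp ha)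
  obtain ⟨M, hM⟩ := eventually_atTop.1 (hlim.eventually (gt_mem_nhds hc2))
  refine ⟨max N M, fun n hn => ?_⟩
  obtain ⟨k, rfl⟩ := Nat.exists_eq_add_of_le (le_of_lt (lt_of_le_of_lt (le_max_left N M) hn))
  have h1 := (key k).trans_lt (hM (N + k) ((le_max_right N M).trans hn.le))
  have h2 := le_max_left (u (N + k) - c / 2) 0
  rw [Real.dist_eq, sub_zero, abs_of_nonneg (hu _)]
  linarith

/-- If `W` and `Z` are independent and `∫ z, F w z ∂(law of Z) = 0` for every `w`, then
`F(W, Z)` has zero mean. -/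
theorem integral_eq_zero_of_indepFun {Ω α β : Type*} [MeasurableSpace Ω] [MeasurableSpace α]
    [MeasurableSpace β] {μ : Measure Ω} [IsProbabilityMeasure μ] {W : Ω → α} {Z : Ω → β}
    (hW : Measurable W) (hZ : Measurable Z) (h : IndepFun W Z μ) {F : α × β → ℝ}
    (hF : Measurable F) {M : ℝ} (hM : ∀ q, |F q| ≤ M)
    (h0 : ∀ w, ∫ z, F (w, z) ∂(μ.map Z) = 0) : ∫ ω, F (W ω, Z ω) ∂μ = 0 := by
  have := Measure.isProbabilityMeasure_map (μ := μ) hW.aemeasurable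
  have := Measure.isProbabilityMeasure_map (μ := μ) hZ.aemeasurable
  have hmap := h.map_prod_eq_prod_map_map hW.aemeasurable hZ.aemeasurable
  have h1 : ∫ ω, F (W ω, Z ω) ∂μ = ∫ q, F q ∂(μ.map fun ω => (W ω, Z ω)) :=
    (integral_map (hW.prodMk hZ).aemeasurable hF.aestronglyMeasurable).symm
  rw [h1, hmap, integral_prod]
  · simp [h0]
  · exact Integrable.of_bound hF.aestronglyMeasurable M (Eventually.of_forall hM)

/-! ### The linear recursion driven by centred noise. -/

section Noise

variable {S H : Type*} [NormedAddCommGroup H] [InnerProductSpace ℝ H]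

/-- The linear recursion `e₀ = 0`, `e_{t+1} = (1 - λ η_t) e_t - η_t ξ(z_t)`. -/
noncomputable def noiseRecursion (lam : ℝ) (η : ℕ → ℝ) (ξ : S → H) (z : ℕ → S) : ℕ → H
  | 0 => 0
  | t + 1 => (1 - lam * η t) • noiseRecursion lam η ξ z t - η t • ξ (z t)

variable {lam : ℝ} {η : ℕ → ℝ} {ξ : S → H} {B : ℝ}

/-- Each step is a convex combination of `e_t` and `-ξ / λ`, with weights `1 - λη` and `λη`, so the
ball of radius `B / λ` is invariant. -/
theorem norm_noiseRecursion_le (hlam : 0 < lam) (hη : ∀ t, 0 ≤ η t) (hη1 : ∀ t, lam * η t ≤ 1)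
    (hB : ∀ z, ‖ξ z‖ ≤ B) (z : ℕ → S) (t : ℕ) : ‖noiseRecursion lam η ξ z t‖ ≤ B / lam := by
  have hB0 : 0 ≤ B := (norm_nonneg _).trans (hB (z 0))
  induction t with
  | zero => simpa [noiseRecursion] using div_nonneg hB0 hlam.le
  | succ t ih =>
    calc _ ≤ ‖(1 - lam * η t) • noiseRecursion lam η ξ z t‖ + ‖η t • ξ (z t)‖ := norm_sub_le _ _
      _ = (1 - lam * η t) * ‖noiseRecursion lam η ξ z t‖ + η t * ‖ξ (z t)‖ := by
        rw [norm_smul, norm_smul, Real.norm_of_nonneg (sub_nonneg.2 (hη1 t)),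
          Real.norm_of_nonneg (hη t)]
      _ ≤ (1 - lam * η t) * (B / lam) + η t * B := by
        gcongr
        · exact sub_nonneg.2 (hη1 t)
        · exact hη t
        · exact hB _
      _ = B / lam := by field_simp; ring

theorem norm_sq_noiseRecursion_succ (z : ℕ → S) (t : ℕ) :
    ‖noiseRecursion lam η ξ z (t + 1)‖ ^ 2 = (1 - lam * η t) ^ 2 * ‖noiseRecursion lam η ξ z t‖ ^ 2
      - 2 * ((1 - lam * η t) * η t) * inner ℝ (noiseRecursion lam η ξ z t) (ξ (z t))
      + η t ^ 2 * ‖ξ (z t)‖ ^ 2 := by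
  rw [noiseRecursion, norm_sub_sq_real, norm_smul, norm_smul, inner_smul_left, inner_smul_right,
    mul_pow, mul_pow, Real.norm_eq_abs, Real.norm_eq_abs, sq_abs, sq_abs]
  simp only [conj_trivial]
  ring

variable {Ω : Type*} [MeasurableSpace Ω] [MeasurableSpace S]

/-- The strict past `σ(Z₀, …, Z_{t-1})` of a process. -/
def pastFiltration (Z : ℕ → Ω → S) (hZ : ∀ t, Measurable (Z t)) :
    Filtration ℕ (inferInstance : MeasurableSpace Ω) where
  seq t := ⨆ s ∈ Set.Iio t, MeasurableSpace.comap (Z s) inferInstance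
  mono' _ _ h := biSup_mono fun _ hs => lt_of_lt_of_le hs h
  le' _ := iSup₂_le fun s _ => (hZ s).comap_le

theorem measurable_pastFiltration {Z : ℕ → Ω → S} (hZ : ∀ t, Measurable (Z t)) {s t : ℕ}
    (h : s < t) : Measurable[pastFiltration Z hZ t] (Z s) :=
  Measurable.mono (comap_measurable (Z s))
    (le_iSup₂_of_le (f := fun s (_ : s ∈ Set.Iio t) =>
      MeasurableSpace.comap (Z s) inferInstance) s h le_rfl) le_rfl

variable {Z : ℕ → Ω → S} (hZ : ∀ t, Measurable (Z t))
  (hξ : Measurable fun q : S × S => (inner ℝ (ξ q.1) (ξ q.2) : ℝ))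
include hξ

/-- Unrolling the recursion leaves only scalar products of noise terms, so no measurable structure
on `H` is needed. -/
theorem measurable_inner_noiseRecursion (n : ℕ) {m : ℕ} (hnm : n ≤ m) :
    Measurable[pastFiltration Z hZ (m + 1)] fun ω =>
      (inner ℝ (noiseRecursion lam η ξ (fun t => Z t ω) n) (ξ (Z m ω)) : ℝ) := by
  induction n with
  | zero => simp only [noiseRecursion, inner_zero_left]; exact measurable_const
  | succ n ih =>
    simp only [noiseRecursion, inner_sub_left, inner_smul_left, conj_trivial]
    refine ((ih (by omega)).const_mul _).sub (Measurable.const_mul ?_ _)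
    exact hξ.comp ((measurable_pastFiltration hZ (by omega)).prodMk
      (measurable_pastFiltration hZ (by omega)))

theorem measurable_norm_sq_noiseRecursion (t : ℕ) :
    Measurable[pastFiltration Z hZ t] fun ω => ‖noiseRecursion lam η ξ (fun t => Z t ω) t‖ ^ 2 := by
  induction t with
  | zero => simp only [noiseRecursion]; exact measurable_const
  | succ t ih =>
    simp only [norm_sq_noiseRecursion_succ, ← real_inner_self_eq_norm_sq (ξ _)]
    refine ((Measurable.const_mul (ih.mono ((pastFiltration Z hZ).mono (Nat.le_succ t)) le_rfl) _).sub
      ((measurable_inner_noiseRecursion hZ hξ t le_rfl).const_mul _)).add (Measurable.const_mul ?_ _)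
    exact hξ.comp ((measurable_pastFiltration hZ (by omega)).prodMk
      (measurable_pastFiltration hZ (by omega)))

variable {μ : Measure Ω} [IsProbabilityMeasure μ] {P : Measure S}
  (hZ_indep : iIndepFun Z μ) (hZ_law : ∀ t, μ.map (Z t) = P)
  (hB : ∀ z, ‖ξ z‖ ≤ B) (h0 : ∀ z, ∫ z', (inner ℝ (ξ z) (ξ z') : ℝ) ∂P = 0)
include hZ hZ_indep hZ_law hB h0

/-- The pair formed by the indicator of `A` and `Z s` is determined by the past, hence independent
of `Z t`. Integrating over past events replaces a conditional expectation. -/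
theorem setIntegral_inner_noise_eq_zero {s t : ℕ} (hst : s < t) {A : Set Ω}
    (hA : MeasurableSet[pastFiltration Z hZ t] A) :
    ∫ ω in A, (inner ℝ (ξ (Z s ω)) (ξ (Z t ω)) : ℝ) ∂μ = 0 := by
  have hA' : MeasurableSet A := (pastFiltration Z hZ).le t A hA
  set W : Ω → ℝ × S := fun ω => (A.indicator (fun _ => 1) ω, Z s ω) with hWdef
  have hWt : Measurable[pastFiltration Z hZ t] W :=
    (measurable_const.indicator hA).prodMk (measurable_pastFiltration hZ hst)
  have hW : Measurable W := hWt.mono ((pastFiltration Z hZ).le t) le_rfl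
  have hind : IndepFun W (Z t) μ := by
    have h1 := indep_iSup_of_disjoint (fun i => (hZ i).comap_le)
      ((iIndepFun_iff_iIndep _ _ _).1 hZ_indep) (S := Set.Iio t) (T := {t}) (by simp)
    rw [IndepFun_iff_Indep]
    refine indep_of_indep_of_le_left (indep_of_indep_of_le_right h1 ?_) hWt.comap_le
    exact le_iSup₂_of_le (f := fun s (_ : s ∈ ({t} : Set ℕ)) =>
      MeasurableSpace.comap (Z s) inferInstance) t rfl le_rfl
  have hk : ∀ z z', |(inner ℝ (ξ z) (ξ z') : ℝ)| ≤ B * B := fun z z' =>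
    (abs_real_inner_le_norm _ _).trans
      (mul_le_mul (hB z) (hB z') (norm_nonneg _) ((norm_nonneg _).trans (hB z)))
  -- Clamping to `[-1, 1]` makes `F` bounded everywhere and does not alter the indicator values `0`
  -- and `1`.
  set F : (ℝ × S) × S → ℝ := fun q => max (-1) (min 1 q.1.1) * inner ℝ (ξ q.1.2) (ξ q.2) with hFdef
  have hF : Measurable F := by
    refine Measurable.mul (by fun_prop) ?_
    exact hξ.comp (measurable_fst.snd.prodMk measurable_snd)
  have hFM : ∀ q, |F q| ≤ B * B := by
    intro q
    rw [hFdef, abs_mul, ← one_mul (B * B)]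
    refine mul_le_mul ?_ (hk _ _) (abs_nonneg _) zero_le_one
    rw [abs_le]
    exact ⟨le_max_left _ _, max_le (by norm_num) (min_le_left _ _)⟩
  have h2 := integral_eq_zero_of_indepFun hW (hZ t) hind hF hFM
    (fun w => by simp only [hFdef, integral_const_mul, hZ_law, h0, mul_zero])
  rw [← integral_indicator hA', ← h2]
  congr 1
  ext ω
  by_cases hω : ω ∈ A <;> simp [hFdef, hWdef, hω]

/-- The time `n` of the recursion is decoupled from the time `t` of the noise, so that induction on
`n` can run with `t` and `A` fixed. -/
theorem setIntegral_inner_noiseRecursion_eq_zero {n t : ℕ} (hnt : n ≤ t) {A : Set Ω}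
    (hA : MeasurableSet[pastFiltration Z hZ t] A)
    (hlam : 0 < lam) (hη : ∀ t, 0 ≤ η t) (hη1 : ∀ t, lam * η t ≤ 1) :
    ∫ ω in A, (inner ℝ (noiseRecursion lam η ξ (fun t => Z t ω) n) (ξ (Z t ω)) : ℝ) ∂μ = 0 := by
  induction n with
  | zero => simp [noiseRecursion]
  | succ n ih =>
    have hint1 : Integrable (fun ω =>
        (inner ℝ (noiseRecursion lam η ξ (fun t => Z t ω) n) (ξ (Z t ω)) : ℝ)) μ := by
      refine Integrable.of_bound (C := B / lam * B) ?_ (Eventually.of_forall fun ω => ?_)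
      · exact ((measurable_inner_noiseRecursion hZ hξ n (by omega)).mono
          ((pastFiltration Z hZ).le _) le_rfl).aestronglyMeasurable
      · exact (abs_real_inner_le_norm _ _).trans
          (mul_le_mul (norm_noiseRecursion_le hlam hη hη1 hB _ _) (hB _) (norm_nonneg _)
            ((norm_nonneg _).trans (norm_noiseRecursion_le hlam hη hη1 hB (fun t => Z t ω) n)))
    have hint2 : Integrable (fun ω => (inner ℝ (ξ (Z n ω)) (ξ (Z t ω)) : ℝ)) μ := by
      refine Integrable.of_bound (C := B * B)
        (hξ.comp ((hZ n).prodMk (hZ t))).aestronglyMeasurable (Eventually.of_forall fun ω => ?_)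
      exact (abs_real_inner_le_norm _ _).trans
        (mul_le_mul (hB _) (hB _) (norm_nonneg _) ((norm_nonneg _).trans (hB (Z n ω))))
    simp only [noiseRecursion, inner_sub_left, inner_smul_left, conj_trivial]
    rw [integral_sub (hint1.const_mul _).integrableOn (hint2.const_mul _).integrableOn,
      integral_const_mul, integral_const_mul, ih (by omega),
      setIntegral_inner_noise_eq_zero hZ hξ hZ_indep hZ_law hB h0 (by omega) hA]
    simp

/-- The linear recursion driven by bounded, centred, independent and identically distributed noise
converges to `0` almost surely, when `∑ η_t = ∞` and `∑ η_t² < ∞`. Only the scalar products of the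
noise have to be measurable. -/
theorem ae_tendsto_norm_noiseRecursion
    (hlam : 0 < lam) (hη : ∀ t, 0 ≤ η t) (hη1 : ∀ t, lam * η t ≤ 1)
    (hη_sum : Tendsto (fun n => ∑ t ∈ Finset.range n, η t) atTop atTop)
    (hη_sq : Summable fun t => η t ^ 2) :
    ∀ᵐ ω ∂μ, Tendsto (fun t => ‖noiseRecursion lam η ξ (fun t => Z t ω) t‖) atTop (𝓝 0) := by
  set Q : ℕ → Ω → ℝ := fun t ω => ‖noiseRecursion lam η ξ (fun t => Z t ω) t‖ ^ 2 with hQdef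
  have hQm : ∀ t, Measurable[pastFiltration Z hZ t] (Q t) :=
    measurable_norm_sq_noiseRecursion hZ hξ
  have hQm' : ∀ t, Measurable (Q t) := fun t => (hQm t).mono ((pastFiltration Z hZ).le t) le_rfl
  have hQ0 : ∀ t ω, 0 ≤ Q t ω := fun t ω => sq_nonneg _
  have hQb : ∀ t ω, Q t ω ≤ (B / lam) ^ 2 := fun t ω =>
    pow_le_pow_left₀ (norm_nonneg _) (norm_noiseRecursion_le hlam hη hη1 hB _ _) 2
  have hQi : ∀ t, Integrable (Q t) μ := fun t =>
    Integrable.of_bound (hQm' t).aestronglyMeasurable ((B / lam) ^ 2)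
      (Eventually.of_forall fun ω => by rw [Real.norm_of_nonneg (hQ0 t ω)]; exact hQb t ω)
  have hIi : ∀ t, Integrable (fun ω =>
      (inner ℝ (noiseRecursion lam η ξ (fun t => Z t ω) t) (ξ (Z t ω)) : ℝ)) μ := by
    intro t
    refine Integrable.of_bound (C := B / lam * B) ?_ (Eventually.of_forall fun ω => ?_)
    · exact ((measurable_inner_noiseRecursion hZ hξ t le_rfl).mono
        ((pastFiltration Z hZ).le _) le_rfl).aestronglyMeasurable
    · exact (abs_real_inner_le_norm _ _).trans
        (mul_le_mul (norm_noiseRecursion_le hlam hη hη1 hB _ _) (hB _) (norm_nonneg _)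
          ((norm_nonneg _).trans (norm_noiseRecursion_le hlam hη hη1 hB (fun t => Z t ω) t)))
  have hstep : ∀ t (A : Set Ω), MeasurableSet[pastFiltration Z hZ t] A →
      ∫ ω in A, Q (t + 1) ω ∂μ ≤
        (1 - lam * η t) ^ 2 * ∫ ω in A, Q t ω ∂μ + μ.real A * (η t ^ 2 * B ^ 2) := by
    intro t A hA
    have hle : ∀ ω, Q (t + 1) ω ≤ ((1 - lam * η t) ^ 2 * Q t ω - 2 * ((1 - lam * η t) * η t) *
        inner ℝ (noiseRecursion lam η ξ (fun t => Z t ω) t) (ξ (Z t ω))) + η t ^ 2 * B ^ 2 := by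
      intro ω
      simp only [hQdef, norm_sq_noiseRecursion_succ]
      gcongr
      exact hB _
    have hi1 := ((hQi t).const_mul ((1 - lam * η t) ^ 2)).integrableOn (s := A)
    have hi2 := ((hIi t).const_mul (2 * ((1 - lam * η t) * η t))).integrableOn (s := A)
    have hi3 : IntegrableOn (fun _ : Ω => η t ^ 2 * B ^ 2) A μ := (integrable_const _).integrableOn
    refine (integral_mono (hQi (t + 1)).integrableOn ((hi1.sub hi2).add hi3) hle).trans_eq ?_
    rw [integral_add' (hi1.sub hi2) hi3, integral_sub' hi1 hi2, integral_const_mul,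
      integral_const_mul, setIntegral_inner_noiseRecursion_eq_zero hZ hξ hZ_indep hZ_law hB h0 le_rfl
        hA hlam hη hη1, setIntegral_const]
    simp
  -- With `A` the whole space and `(1 - λη)² ≤ 1 - λη`, the means satisfy the scalar recursion with
  -- `a = λη`.
  have hmean : Tendsto (fun t => ∫ ω, Q t ω ∂μ) atTop (𝓝 0) := by
    refine tendsto_zero_of_le_one_sub_mul_add (a := fun t => lam * η t)
      (b := fun t => η t * (B ^ 2 / lam)) (fun t => integral_nonneg (hQ0 t))
      (fun t => mul_nonneg hlam.le (hη t)) hη1 ?_ ?_ fun t => ?_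
    · simp only [← Finset.mul_sum]
      exact hη_sum.const_mul_atTop hlam
    · have : Tendsto η atTop (𝓝 0) := by
        have h1 := hη_sq.tendsto_atTop_zero.sqrt
        simpa [Real.sqrt_sq (hη _)] using h1
      simpa using this.mul_const (B ^ 2 / lam)
    · have h1 := hstep t Set.univ MeasurableSet.univ
      simp only [setIntegral_univ, probReal_univ, one_mul] at h1
      refine h1.trans (add_le_add ?_ (le_of_eq (by field_simp)))
      refine mul_le_mul_of_nonneg_right ?_ (integral_nonneg (hQ0 t))
      have := hη1 t
      have := mul_nonneg hlam.le (hη t)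
      nlinarith
  -- The conditional mean of `Q` grows by at most `B² η_t²` at step `t`; the partial sums compensate
  -- for this.
  set f : ℕ → Ω → ℝ := fun t ω => B ^ 2 * ∑ s ∈ Finset.range t, η s ^ 2 - Q t ω with hfdef
  have hfi : ∀ t, Integrable (f t) μ := fun t => (integrable_const _).sub (hQi t)
  have hsub : Submartingale f (pastFiltration Z hZ) μ := by
    refine submartingale_of_setIntegral_le_succ
      (fun t => (measurable_const.sub (hQm t)).stronglyMeasurable) hfi fun t A hA => ?_
    have h1 := hstep t A hA
    have h2 : 0 ≤ ∫ ω in A, Q t ω ∂μ := integral_nonneg (hQ0 t)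
    have h3 : (1 - lam * η t) ^ 2 ≤ 1 :=
      pow_le_one₀ (sub_nonneg.2 (hη1 t)) (by linarith [mul_nonneg hlam.le (hη t)])
    have h4 := mul_le_mul_of_nonneg_right h3 h2
    simp only [hfdef]
    rw [integral_sub (integrable_const _).integrableOn (hQi t).integrableOn,
      integral_sub (integrable_const _).integrableOn (hQi (t + 1)).integrableOn,
      setIntegral_const, setIntegral_const, Finset.sum_range_succ]
    simp only [smul_eq_mul]
    linarith
  have hbdd : ∀ t, eLpNorm (f t) 1 μ ≤
      (B ^ 2 * ∑' s, η s ^ 2 + (B / lam) ^ 2).toNNReal := by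
    intro t
    refine (eLpNorm_le_of_ae_bound (C := B ^ 2 * ∑' s, η s ^ 2 + (B / lam) ^ 2)
      (Eventually.of_forall fun ω => ?_)).trans ?_
    · refine (norm_sub_le _ _).trans (add_le_add ?_ ?_)
      · rw [Real.norm_of_nonneg (mul_nonneg (sq_nonneg _)
          (Finset.sum_nonneg fun _ _ => sq_nonneg _))]
        exact mul_le_mul_of_nonneg_left (hη_sq.sum_le_tsum _ fun _ _ => sq_nonneg _) (sq_nonneg _)
      · rw [Real.norm_of_nonneg (hQ0 t ω)]
        exact hQb t ω
    · simp [ENNReal.ofReal]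
  have hlimSum : Tendsto (fun t => B ^ 2 * ∑ s ∈ Finset.range t, η s ^ 2) atTop
      (𝓝 (B ^ 2 * ∑' s, η s ^ 2)) := hη_sq.hasSum.tendsto_sum_nat.const_mul _
  have hmeas : TendstoInMeasure μ Q atTop (fun _ => 0) := by
    refine tendstoInMeasure_of_tendsto_eLpNorm one_ne_zero
      (fun t => (hQm' t).aestronglyMeasurable) aestronglyMeasurable_const ?_
    have h1 : ∀ t, eLpNorm (Q t - fun _ => 0) 1 μ = ENNReal.ofReal (∫ ω, Q t ω ∂μ) := by
      intro t
      rw [eLpNorm_one_eq_lintegral_enorm,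
        ofReal_integral_eq_lintegral_ofReal (hQi t) (Eventually.of_forall (hQ0 t))]
      refine lintegral_congr fun ω => ?_
      rw [Pi.sub_apply, sub_zero, Real.enorm_of_nonneg (hQ0 t ω)]
    simp only [h1]
    simpa using ENNReal.tendsto_ofReal hmean
  obtain ⟨ns, hns, hae⟩ := hmeas.exists_seq_tendsto_ae
  filter_upwards [hsub.exists_ae_tendsto_of_bdd hbdd, hae] with ω ⟨c, hc⟩ hω
  have hQlim : Tendsto (fun t => Q t ω) atTop (𝓝 (B ^ 2 * ∑' s, η s ^ 2 - c)) := by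
    simpa [hfdef] using hlimSum.sub hc
  -- The almost sure limit is identified along a subsequence, which the convergence in mean
  -- supplies.
  have hzero := tendsto_nhds_unique (hQlim.comp hns.tendsto_atTop) hω
  rw [hzero] at hQlim
  simpa [hQdef, Real.sqrt_sq (norm_nonneg _)] using hQlim.sqrt

end Noise

/-! ### The error of the pruning. -/

section KOMPError

variable {X : Type*} {H : Type*} [NormedAddCommGroup H] [InnerProductSpace ℝ H] [CompleteSpace H]
  [RKHS ℝ H X ℝ]

/-- Errors do not accumulate over removals: every refit is measured against the same target `g`, and
the refitted weights attain the infimum that passed the test. -/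
theorem KOMPLoop.norm_sub_le {g : H} {ε : ℝ} {A B : KernelExpansion X} (h : KOMPLoop g ε A B)
    (hA : ‖g - A.toRKHS H‖ ≤ ε) : ‖g - B.toRKHS H‖ ≤ ε := by
  induction h with
  | empty d w => exact hA
  | halt d w j argmin exceeds => exact hA
  | prune d w j argmin within w' refit B rest ih => exact ih ((le_ciInf refit).trans within)

theorem KOMP.norm_sub_le {ε : ℝ} (hε : 0 ≤ ε) {A B : KernelExpansion X} (h : KOMP H ε A B) :
    ‖A.toRKHS H - B.toRKHS H‖ ≤ ε :=
  KOMPLoop.norm_sub_le h (by simpa using hε)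

end KOMPError

theorem measurable_comp_prodMk {α β γ δ : Type*} [MeasurableSpace α] [MeasurableSpace β]
    [MeasurableSpace γ] [MeasurableSpace δ] {k : β → γ → δ}
    (hk : Measurable fun q : β × γ => k q.1 q.2) {u : α → β} {v : α → γ} (hu : Measurable u)
    (hv : Measurable v) : Measurable fun a => k (u a) (v a) :=
  hk.comp (hu.prodMk hv)

/-! ### Evaluation bounds and measurability in the RKHS. -/

section Kernel

variable {X : Type*} {H : Type*} [NormedAddCommGroup H] [InnerProductSpace ℝ H] [CompleteSpace H]
  [RKHS ℝ H X ℝ]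

theorem inner_kernelSection_kernelSection (x x' : X) :
    inner ℝ (kernelSection H x) (kernelSection H x') = reproducingKernel H x' x := by
  rw [inner_kernelSection, reproducingKernel_eq_kernelSection_apply]

theorem norm_kernelSection (x : X) : ‖kernelSection H x‖ = √(reproducingKernel H x x) := by
  rw [← inner_kernelSection_kernelSection, real_inner_self_eq_norm_sq, Real.sqrt_sq (norm_nonneg _)]

theorem abs_apply_le {K : ℝ} (hK : ∀ x, ‖kernelSection H x‖ ≤ K) (f : H) (x : X) :
    |f x| ≤ ‖f‖ * K := by
  rw [← inner_kernelSection]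
  exact (abs_real_inner_le_norm _ _).trans (mul_le_mul_of_nonneg_left (hK x) (norm_nonneg _))

/-- The functions of a reproducing kernel Hilbert space with measurable kernel are measurable. -/
theorem measurable_rkhs [MeasurableSpace X]
    (hκ : Measurable fun q : X × X => reproducingKernel H q.1 q.2) (f : H) : Measurable ⇑f := by
  -- The measurable elements form a closed subspace containing all kernel sections; anything
  -- orthogonal to these vanishes pointwise, so the subspace is everything.
  let V : Submodule ℝ H :=
    { carrier := {g | Measurable fun x => (inner ℝ g (kernelSection H x) : ℝ)}
      add_mem' := fun {a b} ha hb => by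
        change Measurable fun x => (inner ℝ (a + b) (kernelSection H x) : ℝ)
        simp only [inner_add_left]
        exact Measurable.add ha hb
      zero_mem' := by
        change Measurable fun x => (inner ℝ (0 : H) (kernelSection H x) : ℝ)
        simp only [inner_zero_left]
        exact measurable_const
      smul_mem' := fun c g hg => by
        change Measurable fun x => (inner ℝ (c • g) (kernelSection H x) : ℝ)
        simp only [inner_smul_left]
        exact Measurable.const_mul hg _ }
  have hV : IsClosed (V : Set H) := by
    refine isSeqClosed_iff_isClosed.1 fun u g hu hg => ?_
    exact measurable_of_tendsto_metrizable
      (f := fun n x => (inner ℝ (u n) (kernelSection H x) : ℝ)) hu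
      (tendsto_pi_nhds.2 fun x => hg.inner tendsto_const_nhds)
  have hker : ∀ x, kernelSection H x ∈ V := fun x => by
    change Measurable fun x' => (inner ℝ (kernelSection H x) (kernelSection H x') : ℝ)
    simp only [inner_kernelSection_kernelSection]
    exact measurable_comp_prodMk hκ measurable_id measurable_const
  have : CompleteSpace V := hV.completeSpace_coe
  have htop : V = ⊤ := by
    refine Submodule.orthogonal_eq_bot_iff.1 ((Submodule.eq_bot_iff _).2 fun g hg => ?_)
    refine RKHS.ext fun x => ?_
    have h : inner ℝ g (kernelSection H x) = 0 :=
      Submodule.inner_left_of_mem_orthogonal (hker x) hg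
    rw [RKHS.coe_zero, Pi.zero_apply, ← h, inner_kernelSection]
  have h4 : Measurable fun x => (inner ℝ f (kernelSection H x) : ℝ) := by
    have h : f ∈ V := htop ▸ Submodule.mem_top
    exact h
  simpa only [inner_kernelSection] using h4

end Kernel

/-! ### Derivative of the loss: monotonicity, bound, measurability. -/

section Loss

variable {Y : Type*} {loss : ℝ → Y → ℝ} {C : ℝ}

theorem hasDerivAt_loss (hd : ∀ y, Differentiable ℝ fun z => loss z y) (z : ℝ) (y : Y) :
    HasDerivAt (fun u => loss u y) (lossDeriv loss z y) z :=
  (hd y z).hasDerivAt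

theorem lossDeriv_mono (hd : ∀ y, Differentiable ℝ fun z => loss z y)
    (hc : ∀ y, ConvexOn ℝ Set.univ fun z => loss z y) (y : Y) :
    Monotone fun z => lossDeriv loss z y :=
  monotoneOn_univ.1 ((hc y).monotoneOn_deriv fun z _ => hd y z)

theorem abs_lossDeriv_le (hl : ∀ y z z', |loss z y - loss z' y| ≤ C * |z - z'|) (z : ℝ) (y : Y) :
    |lossDeriv loss z y| ≤ C := by
  have hC : 0 ≤ C := by simpa using (abs_nonneg _).trans (hl y 1 0)
  have h : LipschitzWith C.toNNReal fun z => loss z y :=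
    LipschitzWith.of_dist_le_mul fun a b => by
      simpa [Real.dist_eq, Real.coe_toNNReal C hC] using hl y a b
  simpa [lossDeriv, Real.coe_toNNReal C hC] using norm_deriv_le_of_lipschitz (x₀ := z) h

theorem measurable_uncurry_loss [MeasurableSpace Y] (hm : ∀ z, Measurable (loss z))
    (hd : ∀ y, Differentiable ℝ fun z => loss z y) : Measurable (Function.uncurry loss) :=
  measurable_uncurry_of_continuous_of_measurable (fun y => (hd y).continuous) hm

/-- The derivative is the pointwise limit of difference quotients with increments `1 / (n + 1)`,
each jointly measurable. -/
theorem measurable_lossDeriv [MeasurableSpace Y] (hm : ∀ z, Measurable (loss z))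
    (hd : ∀ y, Differentiable ℝ fun z => loss z y) :
    Measurable fun q : ℝ × Y => lossDeriv loss q.1 q.2 := by
  have hL := measurable_uncurry_loss hm hd
  have hs : Tendsto (fun n : ℕ => (1 / ((n : ℝ) + 1))) atTop (𝓝[≠] 0) :=
    tendsto_nhdsWithin_iff.2 ⟨tendsto_one_div_add_atTop_nhds_zero_nat,
      Eventually.of_forall fun n => (Nat.one_div_pos_of_nat).ne'⟩
  refine measurable_of_tendsto_metrizable (f := fun (n : ℕ) (q : ℝ × Y) =>
    (1 / ((n : ℝ) + 1))⁻¹ • (loss (q.1 + 1 / ((n : ℝ) + 1)) q.2 - loss q.1 q.2)) (fun n => ?_) ?_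
  · refine Measurable.const_mul (Measurable.sub ?_ hL) _
    exact hL.comp ((measurable_fst.add_const _).prodMk measurable_snd)
  · exact tendsto_pi_nhds.2 fun q => (hasDerivAt_loss hd q.1 q.2).tendsto_slope_zero.comp hs

end Loss

/-! ### Stochastic gradient, optimality and continuity of the risk. -/

section Risk

variable {X Y : Type*} {H : Type*} [NormedAddCommGroup H] [InnerProductSpace ℝ H] [CompleteSpace H]
  [RKHS ℝ H X ℝ]

/-- The stochastic gradient `λ f + ℓ'(f(x), y) κ(x, ·)` of the regularized risk. -/
noncomputable def stochasticGradient (loss : ℝ → Y → ℝ) (lam : ℝ) (f : H) (q : X × Y) : H :=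
  lam • f + lossDeriv loss (f q.1) q.2 • kernelSection H q.1

variable {loss : ℝ → Y → ℝ} {C K lam : ℝ}

theorem inner_stochasticGradient (g f : H) (q : X × Y) :
    inner ℝ g (stochasticGradient loss lam f q) =
      lam * inner ℝ g f + lossDeriv loss (f q.1) q.2 * g q.1 := by
  rw [stochasticGradient, inner_add_right, inner_smul_right, inner_smul_right, inner_kernelSection]

/-- Only point values of `f`, `ℓ'` and the kernel remain on the right, which yields joint
measurability. -/
theorem inner_stochasticGradient_stochasticGradient (f : H) (q q' : X × Y) :
    inner ℝ (stochasticGradient loss lam f q) (stochasticGradient loss lam f q') =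
      lam * (lam * inner ℝ f f + lossDeriv loss (f q.1) q.2 * f q.1) +
        lossDeriv loss (f q'.1) q'.2 * (lam * f q'.1 +
          lossDeriv loss (f q.1) q.2 * reproducingKernel H q'.1 q.1) := by
  have h : stochasticGradient loss lam f q q'.1 = lam * f q'.1 +
      lossDeriv loss (f q.1) q.2 * reproducingKernel H q'.1 q.1 := by
    rw [stochasticGradient, RKHS.coe_add, RKHS.coe_smul, RKHS.coe_smul,
      reproducingKernel_eq_kernelSection_apply]
    rfl
  rw [inner_stochasticGradient, real_inner_comm, inner_stochasticGradient, h]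

theorem norm_stochasticGradient_le (hlam : 0 ≤ lam)
    (hl : ∀ y z z', |loss z y - loss z' y| ≤ C * |z - z'|) (hK : ∀ x, ‖kernelSection H x‖ ≤ K)
    (f : H) (q : X × Y) : ‖stochasticGradient loss lam f q‖ ≤ lam * ‖f‖ + C * K := by
  have h := abs_lossDeriv_le hl (f q.1) q.2
  refine (norm_add_le _ _).trans ?_
  rw [norm_smul, norm_smul, Real.norm_of_nonneg hlam, Real.norm_eq_abs]
  gcongr
  · exact (abs_nonneg _).trans h
  · exact hK _

variable [MeasurableSpace X] [MeasurableSpace Y]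

theorem measurable_inner_stochasticGradient
    (hκ : Measurable fun q : X × X => reproducingKernel H q.1 q.2)
    (hm : ∀ z, Measurable (loss z)) (hd : ∀ y, Differentiable ℝ fun z => loss z y) (f : H) :
    Measurable fun q : (X × Y) × (X × Y) =>
      (inner ℝ (stochasticGradient loss lam f q.1) (stochasticGradient loss lam f q.2) : ℝ) := by
  have hf := measurable_rkhs hκ f
  have hD := measurable_lossDeriv hm hd
  have hD' : Measurable fun q : X × Y => lossDeriv loss (f q.1) q.2 :=
    hD.comp ((hf.comp measurable_fst).prodMk measurable_snd)
  have hk : Measurable fun q : (X × Y) × (X × Y) => reproducingKernel H q.2.1 q.1.1 :=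
    measurable_comp_prodMk hκ measurable_snd.fst measurable_fst.fst
  have h1 : Measurable fun q : (X × Y) × (X × Y) => lossDeriv loss (f q.1.1) q.1.2 :=
    hD'.comp measurable_fst
  have h2 : Measurable fun q : (X × Y) × (X × Y) => lossDeriv loss (f q.2.1) q.2.2 :=
    hD'.comp measurable_snd
  have h3 : Measurable fun q : (X × Y) × (X × Y) => f q.1.1 := hf.comp measurable_fst.fst
  have h4 : Measurable fun q : (X × Y) × (X × Y) => f q.2.1 := hf.comp measurable_snd.fst
  simp only [inner_stochasticGradient_stochasticGradient]
  exact (((h1.mul h3).const_add _).const_mul _).add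
    (h2.mul ((h4.const_mul _).add (h1.mul hk)))

variable {P : Measure (X × Y)}

/-- First-order optimality: at a minimizer of the regularized risk, the stochastic gradient is
weakly centred. -/
theorem integral_inner_stochasticGradient_eq_zero [IsProbabilityMeasure P]
    (hκ : Measurable fun q : X × X => reproducingKernel H q.1 q.2)
    (hK : ∀ x, ‖kernelSection H x‖ ≤ K) (hm : ∀ z, Measurable (loss z))
    (hl : ∀ y z z', |loss z y - loss z' y| ≤ C * |z - z'|)
    (hd : ∀ y, Differentiable ℝ fun z => loss z y)
    (hrisk : ∀ f : H, Integrable (fun q : X × Y => loss (f q.1) q.2) P) {f : H}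
    (hf : ∀ g : H, regularizedRisk P loss lam f ≤ regularizedRisk P loss lam g) (g : H) :
    ∫ q, (inner ℝ g (stochasticGradient loss lam f q) : ℝ) ∂P = 0 := by
  have hfm := measurable_rkhs hκ f
  have hgm := measurable_rkhs hκ g
  have hF' : Measurable fun q : X × Y => lossDeriv loss (f q.1) q.2 * g q.1 :=
    ((measurable_lossDeriv hm hd).comp ((hfm.comp measurable_fst).prodMk measurable_snd)).mul
      (hgm.comp measurable_fst)
  have hF : ∀ s : ℝ, Integrable (fun q : X × Y => loss (f q.1 + s * g q.1) q.2) P := fun s => by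
    simpa using hrisk (f + s • g)
  -- Differentiation under the integral along the line `f + s • g`; the Lipschitz bound on the loss
  -- and `|g x| ≤ ‖g‖ K` give a constant dominating function.
  obtain ⟨hint, hder⟩ := hasDerivAt_integral_of_dominated_loc_of_lip (μ := P) (𝕜 := ℝ)
    (F := fun s (q : X × Y) => loss (f q.1 + s * g q.1) q.2) (x₀ := 0) (s := Set.univ)
    (F' := fun q : X × Y => lossDeriv loss (f q.1) q.2 * g q.1)
    (bound := fun _ => C * (‖g‖ * K)) univ_mem
    (Eventually.of_forall fun s => (hF s).aestronglyMeasurable) (hF 0) hF'.aestronglyMeasurable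
    (Eventually.of_forall fun q => by
      refine LipschitzOnWith.of_dist_le_mul fun a _ b _ => ?_
      have hC : 0 ≤ C := (abs_nonneg _).trans (abs_lossDeriv_le hl 0 q.2)
      rw [Real.dist_eq, Real.dist_eq, Real.coe_nnabs]
      calc _ ≤ C * |f q.1 + a * g q.1 - (f q.1 + b * g q.1)| := hl _ _ _
        _ = C * |g q.1| * |a - b| := by
          rw [mul_assoc, ← abs_mul]; congr 2; ring
        _ ≤ C * (‖g‖ * K) * |a - b| := by gcongr; exact abs_apply_le hK g q.1
        _ ≤ _ := by gcongr; exact le_abs_self _)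
    (integrable_const _)
    (Eventually.of_forall fun q => by
      have h1 : HasDerivAt (fun s : ℝ => f q.1 + s * g q.1) (g q.1) 0 := by
        simpa using ((hasDerivAt_id (0 : ℝ)).mul_const (g q.1)).const_add (f q.1)
      have h2 := hasDerivAt_loss hd (f q.1 + 0 * g q.1) q.2
      simpa [Function.comp_def] using h2.comp (0 : ℝ) h1)
  have hsq : HasDerivAt (fun s : ℝ => lam / 2 * ‖f + s • g‖ ^ 2) (lam * inner ℝ g f) 0 := by
    have h1 : HasDerivAt (fun s : ℝ => f + s • g) g 0 := by
      simpa using ((hasDerivAt_id (0 : ℝ)).smul_const g).const_add f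
    have h2 := (h1.norm_sq).const_mul (lam / 2)
    refine h2.congr_deriv ?_
    rw [zero_smul, add_zero, real_inner_comm]
    ring
  have hmin : IsLocalMin (fun s : ℝ => (∫ q, loss (f q.1 + s * g q.1) q.2 ∂P) +
      lam / 2 * ‖f + s • g‖ ^ 2) 0 := by
    refine Eventually.of_forall fun s => ?_
    simpa [regularizedRisk] using hf (f + s • g)
  have h0 := hmin.hasDerivAt_eq_zero (hder.add hsq)
  simp only [inner_stochasticGradient]
  rw [integral_add (integrable_const _) hint]
  simp only [integral_const, probReal_univ, one_smul]
  linarith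

theorem abs_regularizedRisk_sub_le [IsProbabilityMeasure P] (hK : ∀ x, ‖kernelSection H x‖ ≤ K)
    (hl : ∀ y z z', |loss z y - loss z' y| ≤ C * |z - z'|)
    (hrisk : ∀ f : H, Integrable (fun q : X × Y => loss (f q.1) q.2) P) (f g : H) :
    |regularizedRisk P loss lam f - regularizedRisk P loss lam g| ≤
      C * (‖f - g‖ * K) + |lam / 2 * ‖f‖ ^ 2 - lam / 2 * ‖g‖ ^ 2| := by
  have h1 : regularizedRisk P loss lam f - regularizedRisk P loss lam g =
      ∫ q, (loss (f q.1) q.2 - loss (g q.1) q.2) ∂P +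
        (lam / 2 * ‖f‖ ^ 2 - lam / 2 * ‖g‖ ^ 2) := by
    rw [integral_sub (hrisk f) (hrisk g), regularizedRisk, regularizedRisk]
    ring
  rw [h1]
  refine (abs_add_le _ _).trans (add_le_add_left ?_ _)
  have h2 := norm_integral_le_of_norm_le_const (μ := P)
    (f := fun q : X × Y => loss (f q.1) q.2 - loss (g q.1) q.2) (C := C * (‖f - g‖ * K))
    (Eventually.of_forall fun q => by
      have hC : 0 ≤ C := (abs_nonneg _).trans (abs_lossDeriv_le hl 0 q.2)
      refine (hl _ _ _).trans (mul_le_mul_of_nonneg_left ?_ hC)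
      simpa using abs_apply_le hK (f - g) q.1)
  simpa using h2

theorem tendsto_regularizedRisk [IsProbabilityMeasure P] (hK : ∀ x, ‖kernelSection H x‖ ≤ K)
    (hl : ∀ y z z', |loss z y - loss z' y| ≤ C * |z - z'|)
    (hrisk : ∀ f : H, Integrable (fun q : X × Y => loss (f q.1) q.2) P) {f : ℕ → H} {g : H}
    (hf : Tendsto f atTop (𝓝 g)) :
    Tendsto (fun t => regularizedRisk P loss lam (f t) - regularizedRisk P loss lam g)
      atTop (𝓝 0) := by
  refine squeeze_zero_norm (fun t => abs_regularizedRisk_sub_le hK hl hrisk (f t) g) ?_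
  have h1 : Continuous fun u : H =>
      C * (‖u - g‖ * K) + |lam / 2 * ‖u‖ ^ 2 - lam / 2 * ‖g‖ ^ 2| := by fun_prop
  simpa [Function.comp_def] using (h1.tendsto g).comp hf

end Risk

/-! ### Pathwise comparison of the iterates with `g + e`. -/

section Comparison

variable {X Y : Type*} {H : Type*} [NormedAddCommGroup H] [InnerProductSpace ℝ H] [CompleteSpace H]
  [RKHS ℝ H X ℝ] {loss : ℝ → Y → ℝ} {C K lam : ℝ}

/-- One exact gradient step at `f` approaches the linearized step at `g + e`, by monotonicity of
the derivative of the loss. -/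
theorem norm_sq_gradientStep_sub_le (hK : ∀ x, ‖kernelSection H x‖ ≤ K)
    (hl : ∀ y z z', |loss z y - loss z' y| ≤ C * |z - z'|)
    (hd : ∀ y, Differentiable ℝ fun z => loss z y)
    (hc : ∀ y, ConvexOn ℝ Set.univ fun z => loss z y)
    {η : ℝ} (hη : 0 ≤ η) (hη0 : 0 ≤ lam * η) (hη1 : lam * η ≤ 1) (f g e : H) (q : X × Y) :
    ‖((1 - η * lam) • f - (η * lossDeriv loss (f q.1) q.2) • kernelSection H q.1) -
        (g + ((1 - lam * η) • e - η • stochasticGradient loss lam g q))‖ ^ 2 ≤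
      (1 - lam * η) ^ 2 * ‖f - (g + e)‖ ^ 2 + η * (4 * (C * K) * ‖e‖ + 4 * η * (C * K) ^ 2) := by
  set δ := lossDeriv loss (f q.1) q.2 - lossDeriv loss (g q.1) q.2 with hδ
  have hC : 0 ≤ C := (abs_nonneg _).trans (abs_lossDeriv_le hl 0 q.2)
  have hK0 : 0 ≤ K := (norm_nonneg _).trans (hK q.1)
  -- The regularizer contracts the whole difference, and of the loss gradients only the increment
  -- `δ` of `ℓ'` between `g x` and `f x` survives.
  have heq : ((1 - η * lam) • f - (η * lossDeriv loss (f q.1) q.2) • kernelSection H q.1) -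
      (g + ((1 - lam * η) • e - η • stochasticGradient loss lam g q)) =
      (1 - lam * η) • (f - (g + e)) - (η * δ) • kernelSection H q.1 := by
    rw [stochasticGradient, hδ]
    module
  have hδb : |δ| ≤ 2 * C := by
    have := abs_sub (lossDeriv loss (f q.1) q.2) (lossDeriv loss (g q.1) q.2)
    linarith [abs_lossDeriv_le hl (f q.1) q.2, abs_lossDeriv_le hl (g q.1) q.2]
  have hmono : 0 ≤ δ * (f q.1 - g q.1) := by
    have hm := lossDeriv_mono hd hc q.2
    rcases le_total (f q.1) (g q.1) with h | h
    · exact mul_nonneg_of_nonpos_of_nonpos (sub_nonpos.2 (hm h)) (sub_nonpos.2 h)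
    · exact mul_nonneg (sub_nonneg.2 (hm h)) (sub_nonneg.2 h)
  -- Monotonicity controls `δ (f - g)(x)`, but the cross term has `(f - g - e)(x)`; the part from
  -- `e` is paid for here.
  have hcross : δ * e q.1 ≤ 2 * (C * K) * ‖e‖ := by
    calc δ * e q.1 ≤ |δ| * |e q.1| := by rw [← abs_mul]; exact le_abs_self _
      _ ≤ 2 * C * (‖e‖ * K) :=
        mul_le_mul hδb (abs_apply_le hK e q.1) (abs_nonneg _) (by positivity)
      _ = _ := by ring
  have hlast : (|η * δ| * ‖kernelSection H q.1‖) ^ 2 ≤ (η * (2 * C) * K) ^ 2 := by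
    rw [abs_mul, abs_of_nonneg hη]
    gcongr
    exact hK _
  rw [heq, norm_sub_sq_real, norm_smul, norm_smul, inner_smul_left, inner_smul_right,
    inner_kernelSection, mul_pow, Real.norm_eq_abs, Real.norm_eq_abs, sq_abs]
  simp only [conj_trivial, RKHS.coe_sub, RKHS.coe_add, Pi.sub_apply, Pi.add_apply]
  have h1 : δ * e q.1 - δ * (f q.1 - g q.1) ≤ 2 * (C * K) * ‖e‖ := by linarith
  have h2 : 0 ≤ 2 * (C * K) * ‖e‖ := by positivity
  have h3 : (1 - lam * η) * (δ * e q.1 - δ * (f q.1 - g q.1)) ≤ 2 * (C * K) * ‖e‖ :=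
    (mul_le_mul_of_nonneg_left h1 (sub_nonneg.2 hη1)).trans
      (mul_le_of_le_one_left h2 (by linarith))
  have h4 := mul_le_mul_of_nonneg_left h3 (mul_nonneg zero_le_two hη)
  nlinarith

/-- Young's inequality splits `2 x η²` into `λη x²` and `η³ / λ`. The first costs a factor `1 + λη`,
which one of the two factors `1 - λη` absorbs. Here `η²` is the pruning budget. -/
theorem add_sq_le_of_step {D x lam η b : ℝ} (hlam : 0 < lam) (hη : 0 < η) (hη1 : lam * η ≤ 1)
    (hb : 0 ≤ b) (hx : x ^ 2 ≤ (1 - lam * η) ^ 2 * D ^ 2 + η * b) :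
    (x + η ^ 2) ^ 2 ≤ (1 - lam * η) * D ^ 2 +
      lam * η * ((2 * b + η ^ 2 / lam + η ^ 3) / lam) := by
  have hp : 0 < lam * η := mul_pos hlam hη
  have h1 : 2 * x * η ^ 2 ≤ lam * η * x ^ 2 + η ^ 3 / lam := by
    have h : lam * η * x ^ 2 + η ^ 3 / lam - 2 * x * η ^ 2 = η / lam * (lam * x - η) ^ 2 := by
      field_simp
      ring
    have : 0 ≤ η / lam * (lam * x - η) ^ 2 := by positivity
    linarith
  have h2 : (1 + lam * η) * x ^ 2 ≤ (1 + lam * η) * ((1 - lam * η) ^ 2 * D ^ 2 + η * b) :=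
    mul_le_mul_of_nonneg_left hx (by linarith)
  have h3 : (1 + lam * η) * ((1 - lam * η) ^ 2 * D ^ 2) ≤ (1 - lam * η) * D ^ 2 := by
    have h : (1 - lam * η) * D ^ 2 - (1 + lam * η) * ((1 - lam * η) ^ 2 * D ^ 2) =
      (1 - lam * η) * D ^ 2 * (lam * η) ^ 2 := by ring
    have : 0 ≤ (1 - lam * η) * D ^ 2 * (lam * η) ^ 2 :=
      mul_nonneg (mul_nonneg (by linarith) (sq_nonneg _)) (sq_nonneg _)
    linarith
  have h4 : (1 + lam * η) * (η * b) ≤ 2 * (η * b) :=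
    mul_le_mul_of_nonneg_right (by linarith) (mul_nonneg hη.le hb)
  have h5 : lam * η * ((2 * b + η ^ 2 / lam + η ^ 3) / lam) =
      2 * (η * b) + η ^ 3 / lam + η ^ 4 := by field_simp
  nlinarith

/-- Along a run of POLK, if the linear recursion driven by the stochastic gradients at `g` vanishes
in the limit, then the iterates converge to `g`. -/
theorem IsPOLKRun.tendsto_toRKHS (hK : ∀ x, ‖kernelSection H x‖ ≤ K)
    (hl : ∀ y z z', |loss z y - loss z' y| ≤ C * |z - z'|)
    (hd : ∀ y, Differentiable ℝ fun z => loss z y)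
    (hc : ∀ y, ConvexOn ℝ Set.univ fun z => loss z y)
    {η ε : ℕ → ℝ} {z : ℕ → X × Y} {A : ℕ → KernelExpansion X}
    (hA : IsPOLKRun H loss lam η ε z A) (hlam : 0 < lam) (hη : ∀ t, 0 < η t)
    (hη1 : ∀ t, lam * η t ≤ 1) (hε : ∀ t, ε t = η t ^ 2)
    (hη_sum : Tendsto (fun n => ∑ t ∈ Finset.range n, η t) atTop atTop)
    (hη_lim : Tendsto η atTop (𝓝 0)) {g : H}
    (he : Tendsto (fun t => ‖noiseRecursion lam η (stochasticGradient loss lam g) z t‖)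
      atTop (𝓝 0)) :
    Tendsto (fun t => (A t).toRKHS H) atTop (𝓝 g) := by
  set e := noiseRecursion lam η (stochasticGradient loss lam g) z with hedef
  have hC : 0 ≤ C := (abs_nonneg _).trans (abs_lossDeriv_le hl 0 (z 0).2)
  have hK0 : 0 ≤ K := (norm_nonneg _).trans (hK (z 0).1)
  set b : ℕ → ℝ := fun t => 4 * (C * K) * ‖e t‖ + 4 * η t * (C * K) ^ 2 with hbdef
  have hb0 : ∀ t, 0 ≤ b t := fun t => by have := (hη t).le; positivity
  have hb : Tendsto b atTop (𝓝 0) := by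
    simpa using (he.const_mul (4 * (C * K))).add ((hη_lim.const_mul 4).mul_const ((C * K) ^ 2))
  have hD : Tendsto (fun t => ‖(A t).toRKHS H - (g + e t)‖ ^ 2) atTop (𝓝 0) := by
    refine tendsto_zero_of_le_one_sub_mul_add (a := fun t => lam * η t)
      (b := fun t => (2 * b t + η t ^ 2 / lam + η t ^ 3) / lam) (fun t => sq_nonneg _)
      (fun t => mul_nonneg hlam.le (hη t).le) hη1 ?_ ?_ fun t => ?_
    · simp only [← Finset.mul_sum]
      exact hη_sum.const_mul_atTop hlam
    · simpa using (((hb.const_mul 2).add ((hη_lim.pow 2).div_const lam)).add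
        (hη_lim.pow 3)).div_const lam
    · have h1 := (hA.step t).norm_sub_le (by rw [hε]; positivity)
      rw [hε, toRKHS_sgdStep] at h1
      have h2 := norm_sq_gradientStep_sub_le hK hl hd hc (hη t).le
        (mul_nonneg hlam.le (hη t).le) (hη1 t) ((A t).toRKHS H) g (e t) (z t)
      refine le_trans (pow_le_pow_left₀ (norm_nonneg _) ?_ 2)
        (add_sq_le_of_step hlam (hη t) (hη1 t) (hb0 t) h2)
      rw [add_comm _ (η t ^ 2)]
      refine (norm_sub_le_norm_sub_add_norm_sub _ _ _).trans (add_le_add ?_ le_rfl)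
      rwa [norm_sub_rev]
  have hD' : Tendsto (fun t => (A t).toRKHS H - (g + e t)) atTop (𝓝 0) := by
    rw [tendsto_zero_iff_norm_tendsto_zero]
    simpa [Real.sqrt_sq (norm_nonneg _)] using hD.sqrt
  have he' : Tendsto e atTop (𝓝 0) := tendsto_zero_iff_norm_tendsto_zero.2 he
  simpa using hD'.add (he'.const_add g)

end Comparison

/-! ### The main theorem. -/

theorem theorem1
    -- compact feature and target domains, and an RKHS of functions on the feature space
    {p : ℕ} (𝒳 : Set (EuclideanSpace ℝ (Fin p))) (h𝒳 : IsCompact 𝒳)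
    (𝒴 : Set ℝ) (h𝒴 : IsCompact 𝒴)
    {H : Type*} [NormedAddCommGroup H] [InnerProductSpace ℝ H] [CompleteSpace H] [RKHS ℝ H 𝒳 ℝ]
    (hκ_meas : Measurable fun q : 𝒳 × 𝒳 => reproducingKernel H q.1 q.2)
    (hκ_bdd : BddAbove (Set.range fun x : 𝒳 => √(reproducingKernel H x x)))
    -- the loss: uniformly Lipschitz, convex and differentiable in its scalar argument
    (loss : ℝ → 𝒴 → ℝ) (C : ℝ)
    (hloss_meas : ∀ z, Measurable (loss z))
    (hloss_lip : ∀ y z z', |loss z y - loss z' y| ≤ C * |z - z'|)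
    (hloss_convex : ∀ y, ConvexOn ℝ Set.univ fun z => loss z y)
    (hloss_diff : ∀ y, Differentiable ℝ fun z => loss z y)
    -- independent training pairs with common law `P`, for which the risk is finite
    {Ω : Type*} [MeasurableSpace Ω] (μ : Measure Ω) [IsProbabilityMeasure μ]
    (P : Measure (𝒳 × 𝒴)) (Z : ℕ → Ω → 𝒳 × 𝒴)
    (hZ_meas : ∀ t, Measurable (Z t)) (hZ_indep : iIndepFun Z μ)
    (hZ_law : ∀ t, μ.map (Z t) = P)
    (hrisk : ∀ f : H, Integrable (fun q : 𝒳 × 𝒴 => loss (f q.1) q.2) P)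
    -- regularizer, step sizes and approximation budget
    (lam : ℝ) (hlam : 0 < lam) (η ε : ℕ → ℝ)
    (hη_pos : ∀ t, 0 < η t) (hη_lt : ∀ t, η t < 1 / lam)
    (hη_sum : Tendsto (fun n => ∑ t ∈ Finset.range n, η t) atTop atTop)
    (hη_sq : Summable fun t => η t ^ 2)
    (hε : ∀ t, ε t = η t ^ 2)
    -- the minimizer of the regularized expected risk
    (fstar : H)
    (hfstar : ∀ f : H, regularizedRisk P loss lam fstar ≤ regularizedRisk P loss lam f)
    -- the iterates of POLK
    (A : ℕ → Ω → KernelExpansion 𝒳)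
    (hA : ∀ ω, IsPOLKRun H loss lam η ε (fun t => Z t ω) (fun t => A t ω)) :
    (∀ᵐ ω ∂μ,
      liminf (fun t => ((regularizedRisk P loss lam ((A t ω).toRKHS H) -
        regularizedRisk P loss lam fstar : ℝ) : EReal)) atTop = 0) ∧
    (∀ᵐ ω ∂μ, Tendsto (fun t => ‖(A t ω).toRKHS H - fstar‖ ^ 2) atTop (𝓝 0)) := by
  have hbound : ∃ K, ∀ x : 𝒳, ‖kernelSection H x‖ ≤ K := by
    obtain ⟨K, hK⟩ := hκ_bdd
    exact ⟨K, fun x => (norm_kernelSection x).trans_le (hK ⟨x, rfl⟩)⟩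
  obtain ⟨K, hK⟩ := hbound
  have hP : IsProbabilityMeasure P :=
    hZ_law 0 ▸ Measure.isProbabilityMeasure_map (hZ_meas 0).aemeasurable
  have hη1 : ∀ t, lam * η t ≤ 1 := fun t => by
    rw [mul_comm]
    exact ((lt_div_iff₀ hlam).1 (hη_lt t)).le
  have hη_lim : Tendsto η atTop (𝓝 0) := by
    simpa [Real.sqrt_sq (hη_pos _).le] using hη_sq.tendsto_atTop_zero.sqrt
  have hconv : ∀ᵐ ω ∂μ, Tendsto (fun t => (A t ω).toRKHS H) atTop (𝓝 fstar) := by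
    filter_upwards [ae_tendsto_norm_noiseRecursion hZ_meas
      (measurable_inner_stochasticGradient hκ_meas hloss_meas hloss_diff fstar) hZ_indep hZ_law
      (norm_stochasticGradient_le hlam.le hloss_lip hK fstar)
      (fun q => integral_inner_stochasticGradient_eq_zero hκ_meas hK hloss_meas hloss_lip
        hloss_diff hrisk hfstar _) hlam (fun t => (hη_pos t).le) hη1 hη_sum hη_sq] with ω hω
    exact (hA ω).tendsto_toRKHS hK hloss_lip hloss_diff hloss_convex hlam hη_pos hη1 hε hη_sum
      hη_lim hω
  constructor
  · filter_upwards [hconv] with ω hω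
    have h := tendsto_regularizedRisk (lam := lam) hK hloss_lip hrisk hω
    -- The risk gap has the full limit `0`, so its lower limit is `0` as well.
    exact ((continuous_coe_real_ereal.tendsto 0).comp h).liminf_eq
  · filter_upwards [hconv] with ω hω
    simpa using ((hω.sub_const fstar).norm).pow 2
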